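/- Let $n\ge 1$ and let $p_1\ge p_2\ge\dots\ge p_n\ge 0$ with $\sum_{i=1}^n p_i=1$. A list contains the items $1,\dots,n$; its state is the permutation $\pi$ for which $\pi(i)\in\{1,\dots,n\}$ is the position of item $i$. At each step an item is requested, item $i$ with probability $p_i$, independently of the past; the request costs $\pi(i)$, where $\pi$ is the current state. The Transposition rule then swaps the requested item with its immediate predecessor in the list (and does nothing if the requested item is at position $1$). This defines a Markov chain on the set $S_n$ of permutations, which has a stationary distribution; it is unique if all $p_i$ are positive. For every stationary distribution $\mu$ of this chain, the expected access cost satisfies $$\sum_{\pi\in S_n}\mu(\pi)\sum_{i=1}^n p_i\,\pi(i)\;\le\;\mathrm{OPT}+1,\qquad\text{where } \mathrm{OPT}=\sum_{i=1}^n i\,p_i .$$ -/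

import Mathlib

namespace ListUpdate

/-- The Transposition rule on `n` items. A state is a permutation `π` of `Fin n`, where `π i` is
the current position of item `i` (positions are counted from `0`, the front of the list).
When item `i` is requested, it is swapped with the item immediately in front of it;
nothing happens if `i` is already at the front. -/
def transposition {n : ℕ} (π : Equiv.Perm (Fin n)) (i : Fin n) : Equiv.Perm (Fin n) :=
  if (π i : ℕ) = 0 then π
  else
    Equiv.swap i (π.symm ⟨(π i : ℕ) - 1, lt_of_le_of_lt (Nat.sub_le _ _) (π i).isLt⟩) |>.trans π

/-- The transition matrix of the Markov chain on the permutations that Transposition induces when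
requests are independent and item `i` is requested with probability `p i`. -/
def transitionMatrix {n : ℕ} (p : Fin n → ℝ) :
    Matrix (Equiv.Perm (Fin n)) (Equiv.Perm (Fin n)) ℝ :=
  fun π σ => ∑ i : Fin n, if transposition π i = σ then p i else 0

/-- `μ` is a stationary distribution of the Transposition chain: a probability vector on the
permutations that the transition matrix leaves invariant. -/
def IsStationary {n : ℕ} (p : Fin n → ℝ) (μ : Equiv.Perm (Fin n) → ℝ) : Prop :=
  μ ∈ stdSimplex ℝ (Equiv.Perm (Fin n)) ∧ Matrix.vecMul μ (transitionMatrix p) = μ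

/-- The expected access cost in the state `π`. Accessing item `i` costs its position in the list,
counted from `1`. -/
def cost {n : ℕ} (p : Fin n → ℝ) (π : Equiv.Perm (Fin n)) : ℝ :=
  ∑ i : Fin n, p i * (((π i : ℕ) : ℝ) + 1)

/-- The expected access cost when the state is distributed according to `μ`. -/
def expectedCost {n : ℕ} (p : Fin n → ℝ) (μ : Equiv.Perm (Fin n) → ℝ) : ℝ :=
  ∑ π : Equiv.Perm (Fin n), μ π * cost p π

/-- The expected access cost `∑ i * p_i` of the ordering by decreasing probabilities, for
probabilities that are listed in decreasing order. -/
def opt {n : ℕ} (p : Fin n → ℝ) : ℝ :=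
  ∑ i : Fin n, (((i : ℕ) : ℝ) + 1) * p i

end ListUpdate

namespace ListUpdate

open Finset Equiv

/-! A request of `j` is undone by requesting its former predecessor, and every stationary `μ`
satisfies detailed balance along this reversal (`IsStationary.balance`). Hence exchanging
positive-probability items `x`, `y` at distance `d` multiplies `μ` by `(p y / p x) ^ d`
(`IsStationary.mul_swap`).

The excess over `opt` is a sum over inverted pairs, grouped by the less probable item `i`
(`cost_eq`). Let `B` be the set of items `j < i` behind `i`, and `L` the foremost of them. It
suffices that the expectation of `∑ j ∈ B, (p j - p i)` is at most `p i`, since these bounds add up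
to one. Let `p i > 0`. On average `∑ j ∈ B, p j` is at most `#B * p L`, because exchanging `L` with
`j` pairs states so that the one with the likelier item in front weighs more. Exchanging `i` with
`L` is injective, removes exactly `L` from `B`, and raises `μ` by a factor of at least `p L / p i`;
so the mean of `#B * p L` is at most `p i` times the mean of `#B + 1`. That extra one is the whole
loss. -/

variable {n : ℕ}

/-! ### Time reversal of the transitions -/

/-- The item immediately in front of `j`, or `j` itself if `j` is at the front. -/
def pred (σ : Perm (Fin n)) (j : Fin n) : Fin n :=
  σ.symm ⟨(σ j : ℕ) - 1, lt_of_le_of_lt (Nat.sub_le _ _) (σ j).isLt⟩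

lemma apply_pred (σ : Perm (Fin n)) (j : Fin n) : (σ (pred σ j) : ℕ) = σ j - 1 := by
  simp [pred]

lemma transposition_eq (σ : Perm (Fin n)) (j : Fin n) :
    transposition σ j = σ * swap j (pred σ j) := by
  unfold transposition
  split_ifs with h
  · have : pred σ j = j := by
      apply σ.injective
      apply Fin.ext
      rw [apply_pred]
      omega
    rw [this, swap_self]
    rfl
  · rfl

lemma pred_transposition (σ : Perm (Fin n)) (j : Fin n) :
    pred (transposition σ j) (pred σ j) = j := by
  apply (transposition σ j).injective
  apply Fin.ext
  rw [apply_pred]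
  simp only [transposition_eq, Perm.mul_apply, swap_apply_left, swap_apply_right, apply_pred]

lemma transposition_transposition (σ : Perm (Fin n)) (j : Fin n) :
    transposition (transposition σ j) (pred σ j) = σ := by
  rw [transposition_eq (transposition σ j), pred_transposition, transposition_eq, swap_comm j,
    mul_assoc, swap_mul_self, mul_one]

/-- Reversal of the transitions of the chain: the request `j` in state `σ` is undone by the request
`pred σ j` in the next state. -/
def reversal (n : ℕ) : Perm (Perm (Fin n) × Fin n) :=
  Function.Involutive.toPerm (fun x => (transposition x.1 x.2, pred x.1 x.2)) fun x => by
    simp [transposition_transposition, pred_transposition]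

lemma sum_reversal (g : Perm (Fin n) → Fin n → ℝ) :
    ∑ σ, ∑ j, g (transposition σ j) (pred σ j) = ∑ σ, ∑ j, g σ j := by
  rw [← Fintype.sum_prod_type', ← Fintype.sum_prod_type']
  exact Equiv.sum_comp (reversal n) fun x => g x.1 x.2

lemma vecMul_transitionMatrix (p : Fin n → ℝ) (μ : Perm (Fin n) → ℝ) (σ : Perm (Fin n)) :
    Matrix.vecMul μ (transitionMatrix p) σ = ∑ j, μ (transposition σ j) * p (pred σ j) := by
  calc Matrix.vecMul μ (transitionMatrix p) σ
      = ∑ π, ∑ i, if transposition π i = σ then μ π * p i else 0 := by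
        simp [Matrix.vecMul, dotProduct, transitionMatrix, mul_sum]
    _ = ∑ π, ∑ i, if π = σ then μ (transposition π i) * p (pred π i) else 0 := by
        rw [← sum_reversal]
        simp only [transposition_transposition]
    _ = _ := by
        rw [Finset.sum_eq_single σ]
        · simp
        · intro π _ h
          simp [h]
        · simp

/-! ### Product-form weights and existence -/

/-- The items in front of an item of positive probability have positive probability. -/
def PositiveFirst (p : Fin n → ℝ) (σ : Perm (Fin n)) : Prop :=
  ∀ x y, σ x ≤ σ y → 0 < p y → 0 < p x

lemma positiveFirst_of_pred {p : Fin n → ℝ} {σ : Perm (Fin n)}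
    (h : ∀ j, 0 < p j → 0 < p (pred σ j)) : PositiveFirst p σ := by
  have key : ∀ (d : ℕ) (x y : Fin n), (σ y : ℕ) = σ x + d → 0 < p y → 0 < p x := by
    intro d
    induction d with
    | zero =>
      intro x y hd hy
      have : y = x := σ.injective (Fin.ext hd)
      exact this ▸ hy
    | succ d ih =>
      intro x y hd hy
      exact ih x (pred σ y) (by rw [apply_pred]; omega) (h y hy)
  intro x y hxy hy
  exact key (σ y - σ x) x y (by have : (σ x : ℕ) ≤ σ y := hxy; omega) hy

lemma PositiveFirst.mul_swap {p : Fin n → ℝ} {σ : Perm (Fin n)} (h : PositiveFirst p σ)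
    {x y : Fin n} (hx : 0 < p x) (hy : 0 < p y) : PositiveFirst p (σ * swap x y) := by
  have hs : ∀ a, 0 < p (swap x y a) ↔ 0 < p a := by
    intro a
    by_cases hax : a = x
    · subst hax; simp [hx, hy]
    by_cases hay : a = y
    · subst hay; simp [hx, hy]
    rw [swap_apply_of_ne_of_ne hax hay]
  intro a b hab hb
  rw [← hs]
  exact h _ _ hab ((hs b).2 hb)

lemma positiveFirst_mul_swap_iff {p : Fin n → ℝ} {σ : Perm (Fin n)}
    {x y : Fin n} (hx : 0 < p x) (hy : 0 < p y) :
    PositiveFirst p (σ * swap x y) ↔ PositiveFirst p σ := by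
  refine ⟨fun h => ?_, fun h => h.mul_swap hx hy⟩
  have := h.mul_swap hx hy
  rwa [mul_assoc, swap_mul_self, mul_one] at this

/-- The product weight `∏ i, q i ^ (-σ i)`, where `q` is `p` with its zeros replaced by ones. -/
noncomputable def weight (p : Fin n → ℝ) (σ : Perm (Fin n)) : ℝ :=
  ∏ i, (if 0 < p i then p i else 1)⁻¹ ^ (σ i : ℕ)

lemma weight_pos (p : Fin n → ℝ) (σ : Perm (Fin n)) : 0 < weight p σ := by
  refine prod_pos fun i _ => pow_pos (inv_pos.2 ?_) _
  split_ifs with h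
  · exact h
  · exact one_pos

lemma weight_mul_swap {p : Fin n → ℝ} {σ : Perm (Fin n)} {x y : Fin n}
    (hx : 0 < p x) (hy : 0 < p y) (hxy : (σ y : ℕ) = σ x + 1) :
    weight p (σ * swap y x) * p x = weight p σ * p y := by
  set r : Fin n → ℝ := fun i => (if 0 < p i then p i else 1)⁻¹ with hr
  have hne : x ≠ y := by rintro rfl; omega
  have h : weight p (σ * swap y x) * r y = weight p σ * r x := by
    have e (z : Fin n) : r z = ∏ i, if i = z then r z else 1 := by simp
    rw [e y, e x, weight, weight, ← prod_mul_distrib, ← prod_mul_distrib]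
    refine prod_congr rfl fun i _ => ?_
    simp only [Perm.mul_apply]
    change r i ^ _ * _ = r i ^ _ * _
    by_cases hiy : i = y
    · subst hiy
      simp [hne.symm, hxy, pow_succ]
    by_cases hix : i = x
    · subst hix
      simp [hne, hxy, pow_succ]
    · simp [hix, hiy, swap_apply_of_ne_of_ne hiy hix]
  simp only [hr, hx, hy, if_true] at h
  field_simp at h
  linarith

lemma weight_transposition {p : Fin n → ℝ} {σ : Perm (Fin n)} {j : Fin n}
    (hj : 0 < p j) (hq : 0 < p (pred σ j)) :
    weight p (transposition σ j) * p (pred σ j) = weight p σ * p j := by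
  rw [transposition_eq]
  by_cases h : (σ j : ℕ) = 0
  · have : pred σ j = j := σ.injective (Fin.ext (by rw [apply_pred]; omega))
    rw [this, swap_self]
    rfl
  · exact weight_mul_swap hq hj (by rw [apply_pred]; omega)

lemma isStationary_of_balance {p : Fin n → ℝ} (hp_sum : ∑ i, p i = 1) {μ : Perm (Fin n) → ℝ}
    (hμ : μ ∈ stdSimplex ℝ (Perm (Fin n)))
    (h : ∀ σ j, μ (transposition σ j) * p (pred σ j) = μ σ * p j) : IsStationary p μ := by
  refine ⟨hμ, funext fun σ => ?_⟩
  rw [vecMul_transitionMatrix]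
  simp [h, ← mul_sum, hp_sum]

/-- The product weight, cut off outside `PositiveFirst` and normalized, is in detailed balance. The
cutoff handles steps between a positive and a zero item; between two zero items both flows vanish,
so the value substituted for a zero of `p` is immaterial. -/
lemma exists_isStationary {p : Fin n → ℝ} (hp_nonneg : ∀ i, 0 ≤ p i) (hp_sum : ∑ i, p i = 1)
    (hp_anti : Antitone p) :
    ∃ μ : Perm (Fin n) → ℝ, IsStationary p μ ∧ ∀ σ, PositiveFirst p σ → 0 < μ σ := by
  classical
  let w : Perm (Fin n) → ℝ := fun σ => if PositiveFirst p σ then weight p σ else 0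
  have hw0 : ∀ σ, 0 ≤ w σ := fun σ => by
    dsimp only [w]
    split_ifs
    · exact (weight_pos p σ).le
    · exact le_rfl
  have hw : ∀ σ, PositiveFirst p σ → 0 < w σ := fun σ h => by
    simp only [w, if_pos h]
    exact weight_pos p σ
  have hZ : 0 < ∑ σ, w σ := by
    refine sum_pos' (fun σ _ => hw0 σ) ⟨1, mem_univ _, hw 1 ?_⟩
    intro x y hxy hy
    exact hy.trans_le (hp_anti hxy)
  have hbal : ∀ σ j, w (transposition σ j) * p (pred σ j) = w σ * p j := by
    intro σ j
    have out : ∀ (τ : Perm (Fin n)) (i : Fin n), 0 < p i → p (pred τ i) = 0 → w τ = 0 := by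
      intro τ i hi hq
      refine if_neg fun hA => ?_
      have := hA (pred τ i) i (by rw [Fin.le_def, apply_pred]; omega) hi
      exact this.ne' hq
    rcases (hp_nonneg j).eq_or_lt with hj | hj <;>
      rcases (hp_nonneg (pred σ j)).eq_or_lt with hq | hq
    · simp [← hj, ← hq]
    · rw [← hj, out (transposition σ j) (pred σ j) hq (by rw [pred_transposition]; exact hj.symm)]
      simp
    · rw [← hq, out σ j hj hq.symm]
      simp
    · have h := weight_transposition hj hq
      have hA : PositiveFirst p (transposition σ j) ↔ PositiveFirst p σ := by
        rw [transposition_eq]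
        exact positiveFirst_mul_swap_iff hj hq
      simp only [w, hA]
      split_ifs
      · exact h
      · simp
  refine ⟨fun σ => w σ / ∑ τ, w τ, isStationary_of_balance hp_sum ⟨?_, ?_⟩ ?_, ?_⟩
  · exact fun σ => div_nonneg (hw0 σ) hZ.le
  · rw [← sum_div, div_self hZ.ne']
  · intro σ j
    rw [div_mul_eq_mul_div, hbal, div_mul_eq_mul_div]
  · exact fun σ hσ => div_pos (hw σ hσ) hZ

/-! ### Detailed balance for every stationary distribution -/

section Stationary

variable {p : Fin n → ℝ} {μ : Perm (Fin n) → ℝ}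

lemma IsStationary.nonneg (hμ : IsStationary p μ) (σ : Perm (Fin n)) : 0 ≤ μ σ := hμ.1.1 σ

lemma IsStationary.sum_eq_one (hμ : IsStationary p μ) : ∑ σ, μ σ = 1 := hμ.1.2

lemma IsStationary.sum_eq (hμ : IsStationary p μ) (σ : Perm (Fin n)) :
    ∑ j, μ (transposition σ j) * p (pred σ j) = μ σ := by
  rw [← vecMul_transitionMatrix, hμ.2]

/-- In equilibrium the expected one-step change of every function of the state vanishes. -/
lemma IsStationary.sum_drift (hμ : IsStationary p μ) (hp_sum : ∑ i, p i = 1)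
    (g : Perm (Fin n) → ℝ) :
    ∑ σ, ∑ j, μ σ * p j * (g (transposition σ j) - g σ) = 0 := by
  have h1 : ∑ σ, ∑ j, μ σ * p j * g (transposition σ j) = ∑ σ, μ σ * g σ := by
    rw [← sum_reversal]
    refine sum_congr rfl fun σ _ => ?_
    simp only [transposition_transposition]
    rw [← sum_mul, hμ.sum_eq]
  have h2 : ∑ σ, ∑ j, μ σ * p j * g σ = ∑ σ, μ σ * g σ := by
    refine sum_congr rfl fun σ _ => ?_
    rw [← sum_mul, ← mul_sum, hp_sum, mul_one]
  simp only [mul_sub, sum_sub_distrib, h1, h2, sub_self]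

/-- The total position `g` of the zero-probability items never decreases under a request of positive
probability. Its stationary drift vanishes, so no state in the support has a positive item directly
behind a zero one. -/
lemma IsStationary.positiveFirst (hμ : IsStationary p μ) (hp_nonneg : ∀ i, 0 ≤ p i)
    (hp_sum : ∑ i, p i = 1) {σ : Perm (Fin n)} (hσ : μ σ ≠ 0) : PositiveFirst p σ := by
  classical
  let g : Perm (Fin n) → ℝ := fun σ => ∑ z, if p z = 0 then ((σ z : ℕ) : ℝ) else 0
  have hg : ∀ σ j, 0 < p j → g (transposition σ j) - g σ =
      if p (pred σ j) = 0 then ((σ j : ℕ) : ℝ) - (σ (pred σ j) : ℕ) else 0 := by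
    intro σ j hj
    simp only [g]
    rw [← sum_sub_distrib, Finset.sum_eq_single (pred σ j)]
    · rw [transposition_eq]
      split_ifs
      · simp
      · simp
    · intro z _ hz
      by_cases hzj : z = j
      · subst hzj
        simp [hj.ne']
      · rw [transposition_eq, Perm.mul_apply, swap_apply_of_ne_of_ne hzj hz, sub_self]
    · simp
  have hnn : ∀ σ j, 0 ≤ μ σ * p j * (g (transposition σ j) - g σ) := by
    intro σ j
    rcases (hp_nonneg j).eq_or_lt with hj | hj
    · simp [← hj]
    · rw [hg σ j hj]
      refine mul_nonneg (mul_nonneg (hμ.nonneg σ) hj.le) ?_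
      split_ifs
      · rw [sub_nonneg, Nat.cast_le, apply_pred]
        omega
      · exact le_rfl
  have h0 := hμ.sum_drift hp_sum g
  rw [sum_eq_zero_iff_of_nonneg fun σ _ => sum_nonneg fun j _ => hnn σ j] at h0
  have h1 := h0 σ (mem_univ _)
  rw [sum_eq_zero_iff_of_nonneg fun j _ => hnn σ j] at h1
  refine positiveFirst_of_pred fun j hj => (hp_nonneg _).lt_of_ne' fun hq => ?_
  have h2 := h1 j (mem_univ _)
  rw [hg σ j hj, if_pos hq] at h2
  have h3 : ((σ j : ℕ) : ℝ) - (σ (pred σ j) : ℕ) = 0 := by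
    simpa [hσ, hj.ne'] using h2
  have h4 : pred σ j = j := by
    apply σ.injective
    apply Fin.ext
    exact_mod_cast (sub_eq_zero.1 h3).symm
  rw [h4] at hq
  exact hj.ne' hq

/-- A Dirichlet-form argument that needs no irreducibility: the net flow `F` is antisymmetric under
reversal and sums to zero at each state, so the energy of the density `f` vanishes. Each term of
that energy is nonnegative, hence zero. -/
lemma IsStationary.balance (hμ : IsStationary p μ) (hp_nonneg : ∀ i, 0 ≤ p i)
    (hp_sum : ∑ i, p i = 1) (σ : Perm (Fin n)) (j : Fin n) :
    μ (transposition σ j) * p (pred σ j) = μ σ * p j := by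
  let f : Perm (Fin n) → ℝ := fun σ => μ σ / weight p σ
  let F : Perm (Fin n) → Fin n → ℝ := fun σ j =>
    μ σ * p j - μ (transposition σ j) * p (pred σ j)
  have hF : ∀ σ, ∑ j, F σ j = 0 := by
    intro σ
    simp only [F]
    rw [sum_sub_distrib, hμ.sum_eq, ← mul_sum, hp_sum, mul_one, sub_self]
  have hFrev : ∀ σ j, F (transposition σ j) (pred σ j) = -F σ j := by
    intro σ j
    simp only [F, transposition_transposition, pred_transposition]
    ring
  have h1 : ∑ σ, ∑ j, f σ * F σ j = 0 := by
    simp only [← mul_sum, hF, mul_zero, sum_const_zero]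
  have h2 : ∑ σ, ∑ j, f (transposition σ j) * F σ j = 0 := by
    have := sum_reversal fun σ j => f σ * F σ j
    simp only [hFrev, mul_neg, sum_neg_distrib, h1] at this
    simpa using this
  have h3 : ∑ σ, ∑ j, (f σ - f (transposition σ j)) * F σ j = 0 := by
    simp only [sub_mul, sum_sub_distrib, h1, h2, sub_self]
  have out : ∀ (τ : Perm (Fin n)) (i : Fin n), 0 < p i → p (pred τ i) = 0 → μ τ = 0 := by
    intro τ i hi hq
    by_contra hne
    have := hμ.positiveFirst hp_nonneg hp_sum hne (pred τ i) i
      (by rw [Fin.le_def, apply_pred]; omega) hi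
    exact this.ne' hq
  have hcases : ∀ σ j, F σ j = 0 ∨
      (0 < p j ∧ F σ j = weight p σ * p j * (f σ - f (transposition σ j))) := by
    intro σ j
    rcases (hp_nonneg j).eq_or_lt with hj | hj <;>
      rcases (hp_nonneg (pred σ j)).eq_or_lt with hq | hq
    · left
      simp [F, ← hj, ← hq]
    · left
      simp only [F]
      rw [← hj, out (transposition σ j) (pred σ j) hq (by rw [pred_transposition]; exact hj.symm)]
      simp
    · left
      simp only [F]
      rw [← hq, out σ j hj hq.symm]
      simp
    · right
      refine ⟨hj, ?_⟩
      have h := weight_transposition hj hq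
      have hf : ∀ τ, μ τ = weight p τ * f τ := fun τ =>
        (mul_div_cancel₀ _ (weight_pos p τ).ne').symm
      simp only [F]
      rw [hf σ, hf (transposition σ j)]
      linear_combination (-f (transposition σ j)) * h
  -- Where the flow is not already zero, the term is a positive multiple of a square.
  have hnn : ∀ σ j, 0 ≤ (f σ - f (transposition σ j)) * F σ j := by
    intro σ j
    rcases hcases σ j with h | ⟨hj, h⟩
    · simp [h]
    · rw [h, show ∀ a b c : ℝ, a * (b * c * a) = b * c * (a * a) by intros; ring]
      exact mul_nonneg (mul_pos (weight_pos p σ) hj).le (mul_self_nonneg _)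
  rw [sum_eq_zero_iff_of_nonneg fun σ _ => sum_nonneg fun j _ => hnn σ j] at h3
  have h4 := h3 σ (mem_univ _)
  rw [sum_eq_zero_iff_of_nonneg fun j _ => hnn σ j] at h4
  have h5 := h4 j (mem_univ _)
  have h6 : F σ j = 0 := by
    rcases hcases σ j with h | ⟨hj, h⟩
    · exact h
    · rcases mul_eq_zero.1 h5 with h' | h'
      · rw [h, h', mul_zero]
      · exact h'
  exact (sub_eq_zero.1 h6).symm

/-- Exchanging two items at distance `d` changes the stationary probability by the `d`-th power of
the ratio of their probabilities. -/
lemma IsStationary.mul_swap (hμ : IsStationary p μ) (hp_nonneg : ∀ i, 0 ≤ p i)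
    (hp_sum : ∑ i, p i = 1) {x y : Fin n} (hx : 0 < p x) (hy : 0 < p y) (d : ℕ)
    (σ : Perm (Fin n)) (hd : (σ y : ℕ) = σ x + d) :
    μ (σ * swap x y) * p x ^ d = μ σ * p y ^ d := by
  by_cases hA : PositiveFirst p σ
  swap
  · have h1 : μ σ = 0 := by
      by_contra h
      exact hA (hμ.positiveFirst hp_nonneg hp_sum h)
    have h2 : μ (σ * swap x y) = 0 := by
      by_contra h
      exact hA ((positiveFirst_mul_swap_iff hx hy).1 (hμ.positiveFirst hp_nonneg hp_sum h))
    rw [h1, h2, zero_mul, zero_mul]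
  have adj : ∀ (τ : Perm (Fin n)) (a b : Fin n), (τ b : ℕ) = τ a + 1 →
      μ (τ * swap a b) * p a = μ τ * p b := by
    intro τ a b hab
    have hq : pred τ b = a := τ.injective (Fin.ext (by rw [apply_pred]; omega))
    have := hμ.balance hp_nonneg hp_sum τ b
    rwa [transposition_eq, hq, swap_comm] at this
  induction d generalizing σ with
  | zero =>
    have : y = x := σ.injective (Fin.ext hd)
    rw [this, swap_self]
    rfl
  | succ d ih =>
    rcases Nat.eq_zero_or_pos d with rfl | hd0
    · simpa using adj σ x y hd
    -- The exchange is split as `x … z y` → `x … y z` → `y … x z` → `y … z x`; the powers of `p z`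
    -- cancel. `PositiveFirst` makes `p z` positive.
    set z := pred σ y with hz
    have hσz : (σ z : ℕ) = σ x + d := by rw [hz, apply_pred]; omega
    have hzx : z ≠ x := by rintro h; rw [h] at hσz; omega
    have hzy : z ≠ y := by rintro h; rw [h] at hσz; omega
    have hxy : x ≠ y := by rintro h; rw [h] at hd; omega
    have hpz : 0 < p z := hA z y (by rw [Fin.le_def]; omega) hy
    have e1 := adj σ z y (by omega)
    have e2 := ih (σ * swap z y)
      (by simp [swap_apply_of_ne_of_ne hzx.symm hxy, hσz]) (hA.mul_swap hpz hy)
    have e3 := adj (σ * swap z y * swap x y) x z (by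
      simp [swap_apply_of_ne_of_ne hzx hzy, hσz, hd]; omega)
    have hs : σ * swap z y * swap x y * swap x z = σ * swap x y := by
      ext a
      simp only [Perm.mul_apply]
      congr 2
      by_cases hax : a = x
      · subst hax; simp [swap_apply_of_ne_of_ne hzx hzy]
      by_cases hay : a = y
      · subst hay; simp [swap_apply_of_ne_of_ne hxy.symm hzy.symm,
          swap_apply_of_ne_of_ne hzx.symm hxy]
      by_cases haz : a = z
      · subst haz; simp [swap_apply_of_ne_of_ne hzx hzy]
      · simp [swap_apply_of_ne_of_ne hax hay, swap_apply_of_ne_of_ne hax haz,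
          swap_apply_of_ne_of_ne haz hay]
    rw [hs] at e3
    refine mul_right_cancel₀ hpz.ne' ?_
    rw [pow_succ, pow_succ]
    linear_combination (p x ^ d * p z) * e3 + (p z * p z) * e2 + (p z * p y ^ d) * e1

end Stationary

/-! ### Uniqueness -/

/-- By the exchange formula `μ / ν` is unchanged by every swap of two items; swaps generate the
group, so the ratio is constant, and normalization makes it one. -/
lemma isStationary_unique {p : Fin n → ℝ} (hp_pos : ∀ i, 0 < p i) (hp_sum : ∑ i, p i = 1)
    {μ ν : Perm (Fin n) → ℝ} (hμ : IsStationary p μ) (hν : IsStationary p ν)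
    (hν_pos : ∀ σ, 0 < ν σ) : μ = ν := by
  have hp0 : ∀ i, 0 ≤ p i := fun i => (hp_pos i).le
  have hstep : ∀ (x y : Fin n) (σ : Perm (Fin n)), σ x ≤ σ y →
      μ (σ * swap x y) / ν (σ * swap x y) = μ σ / ν σ := by
    intro x y σ hxy
    have hd : (σ y : ℕ) = σ x + (σ y - σ x) := by
      have : (σ x : ℕ) ≤ σ y := hxy
      omega
    have h1 := hμ.mul_swap hp0 hp_sum (hp_pos x) (hp_pos y) _ σ hd
    have h2 := hν.mul_swap hp0 hp_sum (hp_pos x) (hp_pos y) _ σ hd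
    have hX := pow_pos (hp_pos x) ((σ y : ℕ) - σ x)
    have hY := pow_pos (hp_pos y) ((σ y : ℕ) - σ x)
    rw [div_eq_div_iff (hν_pos _).ne' (hν_pos _).ne']
    refine mul_right_cancel₀ (mul_pos hX hY).ne' ?_
    linear_combination (ν σ * p y ^ ((σ y : ℕ) - σ x)) * h1 -
      (μ σ * p y ^ ((σ y : ℕ) - σ x)) * h2
  have hconst : ∀ σ : Perm (Fin n), μ σ / ν σ = μ 1 / ν 1 := by
    intro σ
    induction σ using Perm.swap_induction_on' with
    | one => rfl
    | mul_swap σ x y _ ih =>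
      rw [← ih]
      rcases le_total (σ x) (σ y) with h | h
      · exact hstep x y σ h
      · rw [swap_comm]
        exact hstep y x σ h
  have hmul : ∀ σ, μ σ = μ 1 / ν 1 * ν σ := fun σ => by
    rw [← hconst σ, div_mul_cancel₀ _ (hν_pos σ).ne']
  have hc : μ 1 / ν 1 = 1 := by
    have h := hμ.sum_eq_one
    rw [sum_congr rfl fun σ _ => hmul σ, ← mul_sum, hν.sum_eq_one, mul_one] at h
    exact h
  funext σ
  rw [hmul, hc, one_mul]

/-! ### Inversions and the first overtaken item -/

/-- The items that should precede `i` but are behind it. -/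
def overtaken (i : Fin n) (σ : Perm (Fin n)) : Finset (Fin n) :=
  univ.filter fun j => j < i ∧ σ i < σ j

lemma mem_overtaken {i j : Fin n} {σ : Perm (Fin n)} :
    j ∈ overtaken i σ ↔ j < i ∧ σ i < σ j := by
  simp [overtaken]

lemma val_eq_sum_lt (a : Fin n) : ((a : ℕ) : ℝ) = ∑ j, if j < a then 1 else 0 := by
  rw [sum_boole]
  have : (univ.filter fun b => b < a) = Iio a := by ext; simp
  rw [this, Fin.card_Iio]

/-- The excess cost of a state, decomposed by items. -/
lemma cost_eq (p : Fin n → ℝ) (σ : Perm (Fin n)) :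
    cost p σ = opt p + ∑ i, ∑ j ∈ overtaken i σ, (p j - p i) := by
  have h1 : ∑ i, ∑ j ∈ overtaken i σ, (p j - p i) =
      ∑ i, ∑ j, p i * ((if i < j ∧ σ j < σ i then 1 else 0) -
        if j < i ∧ σ i < σ j then 1 else 0) := by
    -- Each inverted pair is visited once from either end, so renaming the indices turns `p j` into
    -- `p i`.
    have : ∑ i, ∑ j, (if j < i ∧ σ i < σ j then p j else 0) =
        ∑ i, ∑ j, (if i < j ∧ σ j < σ i then p i else 0) := sum_comm
    refine sub_eq_zero.1 (Eq.trans ?_ (sub_eq_zero.2 this))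
    simp only [overtaken, sum_filter, ← sum_sub_distrib]
    refine sum_congr rfl fun i _ => sum_congr rfl fun j _ => ?_
    split_ifs <;> ring
  have h2 : cost p σ - opt p = ∑ i, ∑ j, p i * ((if σ j < σ i then 1 else 0) -
      if j < i then 1 else 0) := by
    rw [cost, opt, ← sum_sub_distrib]
    refine sum_congr rfl fun i _ => ?_
    rw [val_eq_sum_lt (σ i), val_eq_sum_lt i,
      ← Equiv.sum_comp σ fun b => if b < σ i then (1 : ℝ) else 0, ← mul_sum, sum_sub_distrib]
    ring
  rw [h1, ← sub_eq_iff_eq_add', h2]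
  refine sum_congr rfl fun i _ => sum_congr rfl fun j _ => ?_
  congr 1
  rcases lt_trichotomy i j with h | rfl | h
  · simp [h, h.not_gt]
  · simp
  · have hne : σ j ≠ σ i := fun e => h.ne (σ.injective e)
    rcases lt_or_gt_of_ne hne with h' | h' <;> simp [h, h.not_gt, h', h'.not_gt]

/-- The first of the items that should precede `i` but are behind it (`i` if there is none). -/
noncomputable def firstOvertaken (i : Fin n) (σ : Perm (Fin n)) : Fin n :=
  if h : (overtaken i σ).Nonempty then (exists_min_image (overtaken i σ) σ h).choose else i

lemma firstOvertaken_spec {i : Fin n} {σ : Perm (Fin n)} (h : (overtaken i σ).Nonempty) :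
    firstOvertaken i σ ∈ overtaken i σ ∧ ∀ j ∈ overtaken i σ, σ (firstOvertaken i σ) ≤ σ j := by
  rw [firstOvertaken, dif_pos h]
  exact (exists_min_image (overtaken i σ) σ h).choose_spec

lemma firstOvertaken_eq {i L : Fin n} {σ : Perm (Fin n)} (hL : L ∈ overtaken i σ)
    (hmin : ∀ j ∈ overtaken i σ, σ L ≤ σ j) : firstOvertaken i σ = L := by
  have h := firstOvertaken_spec ⟨L, hL⟩
  exact σ.injective (le_antisymm (h.2 L hL) (hmin _ h.1))

lemma overtaken_mul_swap {i x y : Fin n} {σ : Perm (Fin n)} (hx : x ∈ overtaken i σ)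
    (hy : y ∈ overtaken i σ) : overtaken i (σ * swap x y) = overtaken i σ := by
  rw [mem_overtaken] at hx hy
  ext a
  rw [mem_overtaken, mem_overtaken, Perm.mul_apply, Perm.mul_apply,
    swap_apply_of_ne_of_ne hx.1.ne' hy.1.ne']
  by_cases hax : a = x
  · subst hax; simp [hx, hy]
  by_cases hay : a = y
  · subst hay; simp [hx, hy]
  rw [swap_apply_of_ne_of_ne hax hay]

lemma firstOvertaken_mul_swap {i j : Fin n} {σ : Perm (Fin n)} (hj : j ∈ overtaken i σ) :
    firstOvertaken i (σ * swap (firstOvertaken i σ) j) = j := by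
  have h := firstOvertaken_spec ⟨j, hj⟩
  have hB := overtaken_mul_swap h.1 hj
  refine firstOvertaken_eq (hB ▸ hj) fun a ha => ?_
  rw [hB] at ha
  rw [Perm.mul_apply, swap_apply_right, Perm.mul_apply]
  by_cases hax : a = firstOvertaken i σ
  · rw [hax, swap_apply_left]
    exact h.2 j hj
  by_cases hay : a = j
  · rw [hay, swap_apply_right]
  · rw [swap_apply_of_ne_of_ne hax hay]
    exact h.2 a ha

lemma overtaken_mul_swap_first {i : Fin n} {σ : Perm (Fin n)} (h : (overtaken i σ).Nonempty) :
    overtaken i (σ * swap i (firstOvertaken i σ)) =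
      (overtaken i σ).erase (firstOvertaken i σ) := by
  obtain ⟨hL, hmin⟩ := firstOvertaken_spec h
  set L := firstOvertaken i σ
  have hL' := mem_overtaken.1 hL
  ext a
  rw [mem_erase, mem_overtaken, Perm.mul_apply, Perm.mul_apply, swap_apply_left]
  by_cases haL : a = L
  · subst haL
    simp [hL'.2.le]
  by_cases hai : a = i
  · subst hai
    simp [mem_overtaken]
  rw [swap_apply_of_ne_of_ne hai haL]
  constructor
  · rintro ⟨h1, h2⟩
    exact ⟨haL, mem_overtaken.2 ⟨h1, hL'.2.trans h2⟩⟩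
  · rintro ⟨-, h2⟩
    exact ⟨(mem_overtaken.1 h2).1, lt_of_le_of_ne (hmin a h2) fun e => haL (σ.injective e).symm⟩

/-- If `σ` and `τ` have the same image but `i` is further forward in `σ`, then the first overtaken
item of `τ` is also overtaken in `σ`, and lies in front of the first one there: a contradiction. So
the position of `i`, and with it the swapped item, is determined by the image. -/
lemma mul_swap_firstOvertaken_injOn (i : Fin n) :
    Set.InjOn (fun σ : Perm (Fin n) => σ * swap i (firstOvertaken i σ))
      {σ | (overtaken i σ).Nonempty} := by
  have key : ∀ σ τ : Perm (Fin n), (overtaken i σ).Nonempty → (overtaken i τ).Nonempty →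
      σ * swap i (firstOvertaken i σ) = τ * swap i (firstOvertaken i τ) → τ i ≤ σ i := by
    intro σ τ hσ hτ he
    obtain ⟨hL, hmin⟩ := firstOvertaken_spec hσ
    obtain ⟨hM, -⟩ := firstOvertaken_spec hτ
    set L := firstOvertaken i σ
    set M := firstOvertaken i τ
    have hL' := mem_overtaken.1 hL
    have hM' := mem_overtaken.1 hM
    have e1 : σ L = τ M := by simpa using congrArg (fun ρ : Perm (Fin n) => ρ i) he
    by_cases hLM : M = L
    · have := congrArg (fun ρ : Perm (Fin n) => ρ L) he
      simp only [Perm.mul_apply, swap_apply_right, hLM] at this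
      exact this.ge
    have e2 : σ M = τ i := by
      have := congrArg (fun ρ : Perm (Fin n) => ρ M) he
      simpa [swap_apply_of_ne_of_ne hM'.1.ne hLM] using this
    by_contra! hlt
    have := hmin M (mem_overtaken.2 ⟨hM'.1, by rwa [e2]⟩)
    rw [e2, e1] at this
    exact this.not_gt hM'.2
  intro σ hσ τ hτ he
  have hi : σ i = τ i := le_antisymm (key τ σ hτ hσ he.symm) (key σ τ hσ hτ he)
  have hL : firstOvertaken i σ = firstOvertaken i τ := by
    apply (σ * swap i (firstOvertaken i σ)).injective
    have he' : σ * swap i (firstOvertaken i σ) = τ * swap i (firstOvertaken i τ) := he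
    conv_rhs => rw [he']
    simp [hi]
  simp only at he
  rw [hL] at he
  exact mul_right_cancel he

/-! ### Bounding the expected excess of each item -/

section Excess

variable {p : Fin n → ℝ} {μ : Perm (Fin n) → ℝ}

/-- Among the items overtaken by `i`, the first has on average the largest probability. -/
lemma IsStationary.sum_overtaken_le (hμ : IsStationary p μ) (hp_nonneg : ∀ i, 0 ≤ p i)
    (hp_sum : ∑ i, p i = 1) (hp_anti : Antitone p) {i : Fin n} (hi : 0 < p i) :
    ∑ σ, ∑ j ∈ overtaken i σ, μ σ * p j ≤
      ∑ σ, ∑ _j ∈ overtaken i σ, μ σ * p (firstOvertaken i σ) := by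
  let S : Finset (Σ _ : Perm (Fin n), Fin n) := univ.sigma (overtaken i)
  -- After the exchange `j` is first among the same overtaken items; recording the old first item
  -- makes `φ` an involution on `S`.
  let φ : (Σ _ : Perm (Fin n), Fin n) → Σ _ : Perm (Fin n), Fin n := fun x =>
    ⟨x.1 * swap (firstOvertaken i x.1) x.2, firstOvertaken i x.1⟩
  have hS : ∀ x, x ∈ S ↔ x.2 ∈ overtaken i x.1 := fun x => by simp [S]
  have hφS : ∀ x ∈ S, φ x ∈ S := by
    intro x hx
    rw [hS] at hx ⊢
    have h := firstOvertaken_spec ⟨_, hx⟩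
    simp only [φ]
    rw [overtaken_mul_swap h.1 hx]
    exact h.1
  have hφφ : ∀ x ∈ S, φ (φ x) = x := by
    intro x hx
    rw [hS] at hx
    simp only [φ, firstOvertaken_mul_swap hx]
    rw [swap_comm x.2, mul_assoc, swap_mul_self, mul_one]
  let G : (Σ _ : Perm (Fin n), Fin n) → ℝ := fun x =>
    μ x.1 * (p (firstOvertaken i x.1) - p x.2)
  have hsum : ∑ x ∈ S, G (φ x) = ∑ x ∈ S, G x :=
    sum_nbij' φ φ hφS hφS hφφ hφφ fun _ _ => rfl
  -- The pair sums to `(μ σ - μ σ') * (p L - p j)`, where `σ'` is the exchanged state; the factors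
  -- never have opposite signs.
  have hpair : ∀ x ∈ S, 0 ≤ G x + G (φ x) := by
    intro x hx
    rw [hS] at hx
    obtain ⟨hL, hmin⟩ := firstOvertaken_spec ⟨_, hx⟩
    simp only [G, φ, firstOvertaken_mul_swap hx]
    set σ := x.1
    set j := x.2
    set L := firstOvertaken i σ
    have hpL : 0 < p L := hi.trans_le (hp_anti (mem_overtaken.1 hL).1.le)
    have hpj : 0 < p j := hi.trans_le (hp_anti (mem_overtaken.1 hx).1.le)
    have hLj : (σ L : ℕ) ≤ σ j := hmin j hx
    have hK := hμ.mul_swap hp_nonneg hp_sum hpL hpj (σ j - σ L) σ (by omega)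
    set d := (σ j : ℕ) - σ L
    have h0 := hμ.nonneg σ
    have h0' := hμ.nonneg (σ * swap L j)
    rw [show μ σ * (p L - p j) + μ (σ * swap L j) * (p j - p L) =
      (μ σ - μ (σ * swap L j)) * (p L - p j) by ring]
    rcases le_total (p j) (p L) with h | h
    · refine mul_nonneg (sub_nonneg.2 ?_) (sub_nonneg.2 h)
      refine le_of_mul_le_mul_right ?_ (pow_pos hpL d)
      rw [hK]
      exact mul_le_mul_of_nonneg_left (pow_le_pow_left₀ hpj.le h d) h0
    · refine mul_nonneg_of_nonpos_of_nonpos (sub_nonpos.2 ?_) (sub_nonpos.2 h)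
      refine le_of_mul_le_mul_right ?_ (pow_pos hpj d)
      rw [← hK]
      exact mul_le_mul_of_nonneg_left (pow_le_pow_left₀ hpL.le h d) h0'
  have h2 : 0 ≤ ∑ x ∈ S, G x := by
    have := sum_nonneg hpair
    rw [sum_add_distrib, hsum] at this
    linarith
  rw [← sub_nonneg, ← sum_sub_distrib]
  simp only [← sum_sub_distrib, ← mul_sub]
  rwa [sum_sigma] at h2

/-- Mass is transported along the injection that swaps `i` with the first overtaken item. The target
has one overtaken item fewer, which is the source of the `+ 1`. -/
lemma IsStationary.sum_card_overtaken_le (hμ : IsStationary p μ) (hp_nonneg : ∀ i, 0 ≤ p i)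
    (hp_sum : ∑ i, p i = 1) (hp_anti : Antitone p) {i : Fin n} (hi : 0 < p i) :
    ∑ σ, ∑ _j ∈ overtaken i σ, μ σ * p (firstOvertaken i σ) ≤
      ∑ σ, μ σ * p i * (#(overtaken i σ) + 1) := by
  classical
  let S : Finset (Perm (Fin n)) := univ.filter fun σ => (overtaken i σ).Nonempty
  let ψ : Perm (Fin n) → Perm (Fin n) := fun σ => σ * swap i (firstOvertaken i σ)
  let G : Perm (Fin n) → ℝ := fun σ => μ σ * p i * (#(overtaken i σ) + 1)
  have hG : ∀ σ, 0 ≤ G σ := fun σ =>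
    mul_nonneg (mul_nonneg (hμ.nonneg σ) hi.le) (by positivity)
  have hle : ∀ σ ∈ S, ∑ _j ∈ overtaken i σ, μ σ * p (firstOvertaken i σ) ≤ G (ψ σ) := by
    intro σ hσ
    have hne : (overtaken i σ).Nonempty := by simpa [S] using hσ
    obtain ⟨hL, -⟩ := firstOvertaken_spec hne
    have hcard := card_erase_add_one hL
    have hB := overtaken_mul_swap_first hne
    simp only [G, ψ]
    rw [hB, sum_const, nsmul_eq_mul, ← hcard]
    set L := firstOvertaken i σ
    have hL' := mem_overtaken.1 hL
    have hpiL : p i ≤ p L := hp_anti hL'.1.le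
    have hpL : 0 < p L := hi.trans_le hpiL
    have hlt : (σ i : ℕ) < σ L := hL'.2
    obtain ⟨d, hd⟩ := Nat.exists_eq_add_of_lt hlt
    have hK := hμ.mul_swap hp_nonneg hp_sum hi hpL (d + 1) σ (by omega)
    -- At distance `d + 1` one power of `p L / p i` is used; the other `d` are at least one.
    have h1 : μ σ * p L ≤ μ (σ * swap i L) * p i := by
      refine le_of_mul_le_mul_right ?_ (pow_pos hi d)
      calc μ σ * p L * p i ^ d ≤ μ σ * p L * p L ^ d :=
            mul_le_mul_of_nonneg_left (pow_le_pow_left₀ hi.le hpiL d)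
              (mul_nonneg (hμ.nonneg σ) hpL.le)
        _ = μ (σ * swap i L) * p i * p i ^ d := by
            rw [mul_assoc, ← pow_succ', ← hK, pow_succ']
            ring
    push_cast
    rw [mul_comm]
    exact mul_le_mul_of_nonneg_right h1 (by positivity)
  calc ∑ σ, ∑ _j ∈ overtaken i σ, μ σ * p (firstOvertaken i σ)
      = ∑ σ ∈ S, ∑ _j ∈ overtaken i σ, μ σ * p (firstOvertaken i σ) := by
        refine (sum_subset (subset_univ S) fun σ _ hσ => ?_).symm
        have : overtaken i σ = ∅ := by simpa [S, not_nonempty_iff_eq_empty] using hσ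
        rw [this, sum_empty]
    _ ≤ ∑ σ ∈ S, G (ψ σ) := sum_le_sum hle
    _ = ∑ σ ∈ S.image ψ, G σ := by
        rw [sum_image]
        intro σ hσ τ hτ
        exact mul_swap_firstOvertaken_injOn i (by simpa [S] using hσ) (by simpa [S] using hτ)
    _ ≤ ∑ σ, G σ := sum_le_sum_of_subset_of_nonneg (subset_univ _) fun σ _ _ => hG σ

lemma IsStationary.excess_le (hμ : IsStationary p μ) (hp_nonneg : ∀ i, 0 ≤ p i)
    (hp_sum : ∑ i, p i = 1) (hp_anti : Antitone p) (i : Fin n) :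
    ∑ σ, μ σ * ∑ j ∈ overtaken i σ, (p j - p i) ≤ p i := by
  rcases (hp_nonneg i).eq_or_lt with hi | hi
  · refine (sum_eq_zero fun σ _ => ?_).trans_le (hp_nonneg i)
    by_cases hσ : μ σ = 0
    · rw [hσ, zero_mul]
    rw [sum_eq_zero, mul_zero]
    intro j hj
    -- When `p i = 0`, everything behind `i` in a state of the support also has probability zero.
    have hA := hμ.positiveFirst hp_nonneg hp_sum hσ
    have hj' := (mem_overtaken.1 hj).2
    rcases (hp_nonneg j).eq_or_lt with h | h
    · rw [← hi, ← h, sub_zero]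
    · exact absurd hi.symm (hA i j hj'.le h).ne'
  · have h1 := hμ.sum_overtaken_le hp_nonneg hp_sum hp_anti hi
    have h2 := hμ.sum_card_overtaken_le hp_nonneg hp_sum hp_anti hi
    have h3 : ∑ σ, μ σ * p i * (#(overtaken i σ) + 1) =
        ∑ σ, ∑ j ∈ overtaken i σ, μ σ * p i + p i := by
      simp only [mul_add, sum_add_distrib, mul_one, sum_const, nsmul_eq_mul]
      rw [← sum_mul, hμ.sum_eq_one, one_mul]
      congr 1
      exact sum_congr rfl fun σ _ => mul_comm _ _
    simp only [mul_sum, mul_sub, sum_sub_distrib]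
    linarith

lemma IsStationary.expectedCost_le (hμ : IsStationary p μ) (hp_nonneg : ∀ i, 0 ≤ p i)
    (hp_sum : ∑ i, p i = 1) (hp_anti : Antitone p) : expectedCost p μ ≤ opt p + 1 := by
  have h : expectedCost p μ = opt p + ∑ i, ∑ σ, μ σ * ∑ j ∈ overtaken i σ, (p j - p i) := by
    simp only [expectedCost, cost_eq, mul_add, sum_add_distrib]
    rw [← sum_mul, hμ.sum_eq_one, one_mul, sum_comm]
    simp only [mul_sum]
  rw [h, ← hp_sum]
  exact add_le_add_right
    (sum_le_sum fun i _ => hμ.excess_le hp_nonneg hp_sum hp_anti i) _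

end Excess

end ListUpdate

theorem theorem1 (n : ℕ) (p : Fin n → ℝ) (hp_nonneg : ∀ i, 0 ≤ p i)
    (hp_sum : ∑ i, p i = 1) (hp_anti : Antitone p) :
    (∃ μ : Equiv.Perm (Fin n) → ℝ, ListUpdate.IsStationary p μ) ∧
    ((∀ i, 0 < p i) → ∃! μ : Equiv.Perm (Fin n) → ℝ, ListUpdate.IsStationary p μ) ∧
    ∀ μ : Equiv.Perm (Fin n) → ℝ, ListUpdate.IsStationary p μ →
      ListUpdate.expectedCost p μ ≤ ListUpdate.opt p + 1 := by
  obtain ⟨ν, hν, hν_pos⟩ := ListUpdate.exists_isStationary hp_nonneg hp_sum hp_anti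
  refine ⟨⟨ν, hν⟩, fun hp_pos => ⟨ν, hν, fun μ hμ => ?_⟩, fun μ hμ => ?_⟩
  · exact ListUpdate.isStationary_unique hp_pos hp_sum hμ hν fun σ =>
      hν_pos σ fun x _ _ _ => hp_pos x
  · exact hμ.expectedCost_le hp_nonneg hp_sum hp_anti
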